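/- Let $(K,\delta)$ be a differential field of arbitrary characteristic, and let $K\{x\}=K[x_0,x_1,x_2,\dots]$ be the ring of differential polynomials in one indeterminate, where $x_j=\delta^j x$, with the derivation extending that of $K$ and satisfying $\delta(x_j)=x_{j+1}$. For $f\in K\{x\}\setminus K$, the order $\operatorname{ord} f$ is the largest $n$ such that $x_n$ appears in $f$, the degree $\deg f$ is the degree of $f$ in $x_n$ with $n=\operatorname{ord} f$, the rank of $f$ is the pair $(\operatorname{ord} f,\deg f)$, and ranks are compared lexicographically; the nonzero elements of $K$ are regarded as having rank smaller than all of these. The separant of $f$ is $s_f=\partial f/\partial x_n$ with $n=\operatorname{ord} f$. An element $f$ of an ideal $I$ is of minimal rank in $I$ if $f\neq 0$ and no nonzero element of $I$ has smaller rank than $f$. An ideal $I$ of $K\{x\}$ is differential if $\delta(I)\subseteq I$; $[f]$ denotes the smallest differential ideal containing $f$; and $I:s^\infty=\{h\in K\{x\}: s^m h\in I\text{ for some } m\geq 0\}$. A field extension $L/K$ (not necessarily algebraic) is separable if $K$ has characteristic $0$, or $K$ has characteristic $p>0$ and $K$ is linearly disjoint from $L^p$ over $K^p$. A separable prime differential ideal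 of $K\{x\}$ is a prime differential ideal $P$ such that $\operatorname{Frac}(K\{x\}/P)$ is a separable field extension of $K$. Theorem. 1. If $P$ is a nonzero separable prime differential ideal of $K\{x\}$, then $P=[f]:s_f^\infty$ for any irreducible $f$ of minimal rank in $P$. 2. If $f\in K\{x\}$ is irreducible with $s_f\neq 0$, then $[f]:s_f^\infty$ is a separable prime differential ideal and $f$ is of minimal rank in it. -/

import Mathlib

open scoped Differential

/-- A field extension `L / K` is separable if it has characteristic zero, or it has
characteristic `p > 0` and `K` is linearly disjoint from `L ^ p` over `K ^ p` (inside `L`). The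
extension need not be algebraic. -/
def IsSeparableExtension (K L : Type*) [Field K] [Field L] [Algebra K L] : Prop :=
  ∀ (p : ℕ) [Fact p.Prime] [CharP K p],
    haveI : CharP L p := charP_of_injective_algebraMap (algebraMap K L).injective p
    ((frobenius L p).fieldRange.toIntermediateField (K := (frobenius K p).fieldRange)
      (fun x => by
        obtain ⟨y, hy⟩ := x.2
        exact ⟨algebraMap K L y, by
          rw [← RingHom.map_frobenius, hy]; rfl⟩)).LinearDisjoint K

section DifferentialIdeals

variable {R : Type*} [CommRing R]

/-- An ideal `I` of a differential ring is differential if it is closed under the derivation. -/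
def IsDifferentialIdeal [Differential R] (I : Ideal R) : Prop :=
  ∀ a ∈ I, a′ ∈ I

/-- `[A]`: the differential ideal generated by `A`, i.e. the smallest differential ideal
containing `A`. -/
def differentialSpan [Differential R] (A : Set R) : Ideal R :=
  sInf {I : Ideal R | IsDifferentialIdeal I ∧ A ⊆ I}

/-- `I : s^∞`: the ideal of all `h` such that `s ^ m * h ∈ I` for some `m ≥ 0`. -/
def idealSaturation (I : Ideal R) (s : R) : Ideal R where
  carrier := {h | ∃ m : ℕ, s ^ m * h ∈ I}
  zero_mem' := ⟨0, by simp⟩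
  add_mem' := by
    rintro a b ⟨m, hm⟩ ⟨n, hn⟩
    refine ⟨m + n, ?_⟩
    have h : s ^ (m + n) * (a + b) = s ^ n * (s ^ m * a) + s ^ m * (s ^ n * b) := by ring
    rw [h]
    exact I.add_mem (I.mul_mem_left _ hm) (I.mul_mem_left _ hn)
  smul_mem' := by
    rintro c a ⟨m, hm⟩
    refine ⟨m, ?_⟩
    have h : s ^ m * (c • a) = c * (s ^ m * a) := by rw [smul_eq_mul]; ring
    rw [h]
    exact I.mul_mem_left _ hm

end DifferentialIdeals

/-- The ring of differential polynomials `K{x} = K[x₀, x₁, x₂, …]` in one differential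
indeterminate `x`, where `x_j` stands for `δ^j x`. -/
abbrev DiffPoly (K : Type*) [CommRing K] := MvPolynomial ℕ K

namespace DiffPoly

noncomputable section

section Derivation

variable {K : Type*} [CommRing K] [Differential K]

/-- The derivation `f ↦ f^δ` applying the derivation of `K` to the coefficients of `f`. -/
def coeffDeriv : Derivation ℤ (DiffPoly K) (DiffPoly K) where
  toLinearMap := AddMonoidHom.toIntLinearMap
    { toFun := fun f =>
        AddMonoidAlgebra.map (Differential.deriv (R := K)).toLinearMap.toAddMonoidHom f
      map_zero' := by ext; simp
      map_add' := fun f g => by ext; simp }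
  map_one_eq_zero' := by
    ext; simp [MvPolynomial.coeff_one]; split <;> simp
  leibniz' f g := by
    classical
    ext m
    simp only [AddMonoidHom.coe_toIntLinearMap, AddMonoidHom.coe_mk, ZeroHom.coe_mk,
      MvPolynomial.coeff_addMonoidAlgebraMap, smul_eq_mul, MvPolynomial.coeff_add,
      MvPolynomial.coeff_mul, LinearMap.toAddMonoidHom_coe, map_sum, Derivation.coeFn_coe,
      Derivation.leibniz, Finset.sum_add_distrib]
    congr 1
    exact Finsupp.sum_antidiagonal_swap m fun a b =>
      MvPolynomial.coeff b g * (MvPolynomial.coeff a f)′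

theorem coeff_coeffDeriv (f : DiffPoly K) (m : ℕ →₀ ℕ) :
    MvPolynomial.coeff m (coeffDeriv f) = (MvPolynomial.coeff m f)′ := rfl

/-- The derivation of `K{x}`: `δ f = f^δ + ∑ⱼ (∂f/∂x_j) x_{j+1}`. -/
instance : Differential (DiffPoly K) where
  deriv := coeffDeriv + (MvPolynomial.mkDerivation K fun j : ℕ =>
    (MvPolynomial.X (j + 1) : DiffPoly K)).restrictScalars ℤ

theorem deriv_C (a : K) : (MvPolynomial.C a : DiffPoly K)′ = MvPolynomial.C a′ := by
  have h : coeffDeriv (MvPolynomial.C a : DiffPoly K) = MvPolynomial.C a′ := by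
    ext m
    rw [coeff_coeffDeriv]
    simp only [MvPolynomial.coeff_C]
    split <;> simp
  change coeffDeriv (MvPolynomial.C a) + MvPolynomial.mkDerivation K _ (MvPolynomial.C a) = _
  rw [h, ← MvPolynomial.algebraMap_eq, Derivation.map_algebraMap, add_zero]

theorem deriv_X (j : ℕ) : (MvPolynomial.X j : DiffPoly K)′ = MvPolynomial.X (j + 1) := by
  have h : coeffDeriv (MvPolynomial.X j : DiffPoly K) = 0 := by
    ext m
    rw [coeff_coeffDeriv]
    simp only [MvPolynomial.coeff_X, MvPolynomial.coeff_zero]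
    split <;> simp
  change coeffDeriv (MvPolynomial.X j) + MvPolynomial.mkDerivation K _ (MvPolynomial.X j) = _
  rw [h, MvPolynomial.mkDerivation_X, zero_add]

end Derivation

section Rank

variable {K : Type*} [CommRing K]

/-- The order of `f`: the largest `n` such that `x_n` appears in `f` (and `⊥` if `f ∈ K`). -/
def ord (f : DiffPoly K) : WithBot ℕ := f.vars.max

/-- The rank of `f`: the pair `(ord f, deg f)`, ordered lexicographically, where `deg f` is the
degree of `f` in its leader `x_n`, `n = ord f`. Elements of `K` get the least value `⊥`. -/
def rank (f : DiffPoly K) : WithBot (ℕ ×ₗ ℕ) :=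
  (ord f).map fun n => toLex (n, f.degreeOf n)

/-- The separant `s_f`: the partial derivative of `f` with respect to its leader
(and `0` if `f ∈ K`, when there is no leader). -/
def separant (f : DiffPoly K) : DiffPoly K :=
  WithBot.recBotCoe 0 (fun n : ℕ => MvPolynomial.pderiv n f) (ord f)

/-- `f` is of minimal rank in `I`, i.e. among the nonzero elements of `I`. -/
def HasMinimalRank (f : DiffPoly K) (I : Ideal (DiffPoly K)) : Prop :=
  f ∈ I ∧ f ≠ 0 ∧ ∀ g ∈ I, g ≠ 0 → rank f ≤ rank g

end Rank

/-- A separable prime differential ideal of `K{x}`: a prime ideal `P`, closed under `δ`, such that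
`Frac(K{x}/P)` is a separable field extension of `K`. -/
structure IsSeparablePrimeDifferential {K : Type*} [Field K] [Differential K]
    (P : Ideal (DiffPoly K)) : Prop where
  isPrime : P.IsPrime
  isDifferential : IsDifferentialIdeal P
  isSeparable : IsSeparableExtension K (FractionRing (DiffPoly K ⧸ P))

end

end DiffPoly

/-! Let `f` have order `n` and separant `s`. Each derivative `δ^(i+1) f` is `s * x_{n+i+1}` plus
terms in variables up to `x_{n+i}`, so modulo `[f]` every `g` satisfies `s^a g ≡ r` for some `r` of
order at most `n` (`exists_pow_mul_sub_mem_differentialSpan`). All questions thus reduce to order at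
most `n`, where membership becomes divisibility by `f`.

Part 2: over `Frac (K{x}/(f))`, where `s ≠ 0`, the equations `δ^i f = 0` can be solved successively
for the higher variables. The resulting homomorphism to a field has kernel `[f] : s^∞`, which is
therefore prime and contains, in order at most `n`, only multiples of `f`. Separability comes from
`dvd_of_dvd_sum_C_mul_pow_char`: if `f` divides `∑ b_i g_i^p`, with `b` a basis of `K` over `K^p`,
then `f` divides every `g_i`.

Part 1: pseudo-division and minimality show that `f` divides all elements of `P` of order at most
`n`. If `s` were zero, every partial derivative of `f` would vanish; in characteristic `p`,
separability would then give `f^p ∣ f`. Once `s ≠ 0`, hence `s ∉ P`, reduction identifies `P` with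
`[f] : s^∞`. -/

section SeparableExtension

variable {K L : Type*} [Field K] [Field L] [Algebra K L]

/-- Linear disjointness can be tested on one basis of `K` over `K^p`, and the coefficients in `L^p`
are exactly the powers `u i ^ p`. -/
theorem isSeparableExtension_iff_basis :
    IsSeparableExtension K L ↔ ∀ (p : ℕ) [Fact p.Prime] [CharP K p],
      ∀ (s : Finset (Module.Basis.ofVectorSpaceIndex (frobenius K p).fieldRange K))
        (u : Module.Basis.ofVectorSpaceIndex (frobenius K p).fieldRange K → L),
        ∑ i ∈ s, algebraMap K L (Module.Basis.ofVectorSpace (frobenius K p).fieldRange K i)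
          * u i ^ p = 0 → ∀ i ∈ s, u i = 0 := by
  refine forall_congr' fun p => forall_congr' fun _ => forall_congr' fun _ => ?_
  have : CharP L p := charP_of_injective_algebraMap (algebraMap K L).injective p
  have hp : p ≠ 0 := (Fact.out : p.Prime).ne_zero
  set b := Module.Basis.ofVectorSpace (frobenius K p).fieldRange K
  refine Iff.trans ⟨fun H => H.linearIndependent_right' b.linearIndependent,
    fun H => IntermediateField.LinearDisjoint.of_basis_right' b H⟩ ?_
  rw [linearIndependent_iff']
  constructor
  · intro H s u hu i hi
    have := H s (fun i => ⟨u i ^ p, ⟨u i, rfl⟩⟩) (by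
      rw [← hu]
      exact Finset.sum_congr rfl fun i _ => by
        rw [IntermediateField.smul_def, smul_eq_mul, mul_comm]; rfl) i hi
    exact pow_eq_zero_iff hp |>.1 (congrArg Subtype.val this)
  · intro H s g hg i hi
    have hu : ∀ j, ∃ v : L, v ^ p = (g j : L) := fun j => (g j).2
    choose u hu using hu
    have := H s u (by
      rw [← hg]
      exact Finset.sum_congr rfl fun i _ => by
        rw [IntermediateField.smul_def, smul_eq_mul, mul_comm, hu]; rfl) i hi
    apply Subtype.ext
    rw [← hu, this, zero_pow hp]; rfl

end SeparableExtension

namespace MvPolynomial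

/-! ### Expansions in `p`-th powers over a basis of `K` over `K^p` -/

section FrobeniusBasis

variable {σ K ι : Type*} [Field K] {p : ℕ} [Fact p.Prime] [CharP K p]

theorem coeff_smul_pow_char (u : MvPolynomial σ K) (m : σ →₀ ℕ) :
    coeff (p • m) (u ^ p) = coeff m u ^ p := by
  rw [← map_frobenius_expand, coeff_map, coeff_expand_smul _ (Fact.out : p.Prime).ne_zero]
  rfl

/-- The coefficient at the exponent `p • m` is a `K^p`-linear relation among the `e i`. -/
theorem eq_zero_of_sum_C_mul_pow_char_eq_zero {e : ι → K}
    (he : LinearIndependent (frobenius K p).fieldRange e) (s : Finset ι)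
    (u : ι → MvPolynomial σ K) (h : ∑ i ∈ s, C (e i) * u i ^ p = 0) : ∀ i ∈ s, u i = 0 := by
  intro i hi
  ext m
  have hm := congrArg (coeff (p • m)) h
  simp only [coeff_sum, coeff_C_mul, coeff_smul_pow_char, coeff_zero] at hm
  have := linearIndependent_iff'.1 he s (fun i => ⟨coeff m (u i) ^ p, ⟨coeff m (u i), rfl⟩⟩) (by
    rw [← hm]
    exact Finset.sum_congr rfl fun i _ => by rw [Subfield.smul_def, smul_eq_mul, mul_comm]) i hi
  exact pow_eq_zero_iff (Fact.out : p.Prime).ne_zero |>.1 (congrArg Subtype.val this)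

/-- Polynomials all of whose partial derivatives vanish, in characteristic `p`: their exponents
are divisible by `p`. -/
theorem exists_eq_sum_C_mul_pow_char (b : Module.Basis ι (frobenius K p).fieldRange K)
    {t : Set σ} {h : MvPolynomial σ K} (ht : h ∈ supported K t) (hd : ∀ j, pderiv j h = 0) :
    ∃ u : ι →₀ MvPolynomial σ K, (∀ i, u i ∈ supported K t) ∧
      h = u.sum fun i v => C (b i) * v ^ p := by
  classical
  have hp : p ≠ 0 := (Fact.out : p.Prime).ne_zero
  have key : ∀ m ∈ h.support, ∃ u : ι →₀ MvPolynomial σ K, (∀ i, u i ∈ supported K t) ∧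
      monomial m (coeff m h) = u.sum fun i v => C (b i) * v ^ p := by
    intro m hm
    have hdvd : ∀ j, p ∣ m j := by
      intro j
      rcases Nat.eq_zero_or_pos (m j) with h0 | hpos
      · simp [h0]
      have h1 := congrArg (coeff (m - Finsupp.single j 1)) (hd j)
      have hle : Finsupp.single j 1 ≤ m := Finsupp.single_le_iff.2 hpos
      rw [coeff_pderiv, tsub_add_cancel_of_le hle, coeff_zero] at h1
      rcases mul_eq_zero.1 h1 with h1 | h1
      · exact absurd h1 (mem_support_iff.1 hm)
      · rw [← CharP.cast_eq_zero_iff K p]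
        have : m j = m j - 1 + 1 := by omega
        rw [this]
        simpa using h1
    obtain ⟨m', rfl⟩ : ∃ m' : σ →₀ ℕ, m = p • m' :=
      ⟨m.mapRange (· / p) (by simp), by ext j; simp [Nat.mul_div_cancel' (hdvd j)]⟩
    have hroot : ∀ y : (frobenius K p).fieldRange, ∃ z : K, z ^ p = y := fun y => y.2
    choose r hr using hroot
    -- Needed for the chosen `p`-th roots of the coordinates to remain finitely supported.
    have hr0 : r 0 = 0 := (pow_eq_zero_iff hp).1 (hr 0)
    refine ⟨(b.repr (coeff (p • m') h)).mapRange (fun y => monomial m' (r y)) (by simp [hr0]),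
      fun i => ?_, ?_⟩
    · rw [Finsupp.mapRange_apply, mem_supported]
      intro j hj
      refine mem_supported.1 ht ((mem_vars_iff_mem_support j).2 ⟨_, hm, ?_⟩)
      by_cases h0 : r (b.repr (coeff (p • m') h) i) = 0
      · simp [h0] at hj
      · rw [vars_monomial h0] at hj
        simpa [hp] using hj
    · rw [Finsupp.sum_mapRange_index (by simp [hp])]
      simp only [monomial_pow, C_mul_monomial, hr]
      conv_lhs => rw [← b.linearCombination_repr (coeff (p • m') h)]
      rw [Finsupp.linearCombination_apply, Finsupp.sum, Finsupp.sum, map_sum]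
      exact Finset.sum_congr rfl fun i _ => by rw [Subfield.smul_def, smul_eq_mul, mul_comm]
  choose! u hu hsum using key
  refine ⟨∑ m ∈ h.support, u m, fun i => ?_, ?_⟩
  · rw [Finsupp.finsetSum_apply]
    exact Subalgebra.sum_mem _ fun m hm => hu m hm i
  · rw [← Finsupp.sum_finsetSum_index (by simp [hp])
      (fun i v w => by rw [add_pow_char, mul_add]), ← Finset.sum_congr rfl hsum]
    exact h.as_sum

end FrobeniusBasis

/-! ### Partial derivatives and divisibility -/

section Degree

variable {σ K : Type*} [Field K]

theorem degreeOf_pderiv_lt {i : σ} {f : MvPolynomial σ K} (h : 0 < degreeOf i f) :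
    degreeOf i (pderiv i f) < degreeOf i f := by
  rw [degreeOf_lt_iff h]
  intro m hm
  rw [mem_support_iff, coeff_pderiv] at hm
  have := (degreeOf_le_iff (n := i)).1 le_rfl _ (mem_support_iff.2 (left_ne_zero_of_mul hm))
  simp at this
  omega

theorem degreeOf_le_of_dvd {i : σ} {f g : MvPolynomial σ K} (hg : g ≠ 0) (h : f ∣ g) :
    degreeOf i f ≤ degreeOf i g := by
  obtain ⟨q, rfl⟩ := h
  rw [degreeOf_mul_eq (left_ne_zero_of_mul hg) (right_ne_zero_of_mul hg)]
  omega

/-- Differentiation lowers the degree in `x_i`, so a nonzero derivative cannot be a multiple of `f`.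
-/
theorem pderiv_eq_zero_of_dvd {i : σ} {f : MvPolynomial σ K} (h : f ∣ pderiv i f) :
    pderiv i f = 0 := by
  by_contra h0
  rcases Nat.eq_zero_or_pos (degreeOf i f) with hd | hd
  · exact h0 (pderiv_eq_zero_of_notMem_vars fun hi => by
      classical
      rw [vars_def, Multiset.mem_toFinset, ← Multiset.count_pos, ← degreeOf_def] at hi
      omega)
  · exact absurd (degreeOf_le_of_dvd (i := i) h0 h) (not_le.2 (degreeOf_pderiv_lt hd))

theorem pderiv_mem_supported {t : Set σ} {f : MvPolynomial σ K} (hf : f ∈ supported K t) (i : σ) :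
    pderiv i f ∈ supported K t := by
  classical
  refine Algebra.adjoin_induction (p := fun x _ => pderiv i x ∈ supported K t) ?_ ?_ ?_ ?_ hf
  · rintro _ ⟨j, hj, rfl⟩
    rw [pderiv_X, Pi.single_apply]
    split
    · exact one_mem _
    · exact zero_mem _
  · intro r
    rw [algebraMap_eq, pderiv_C]
    exact zero_mem _
  · intro x y _ _ hx hy
    rw [map_add]
    exact add_mem hx hy
  · intro x y hx hy hx' hy'
    rw [pderiv_mul]
    exact add_mem (mul_mem hx' hy) (mul_mem hx hy')

theorem pderiv_eq_zero_of_mem_supported {t : Set σ} {f : MvPolynomial σ K}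
    (hf : f ∈ supported K t) {i : σ} (hi : i ∉ t) : pderiv i f = 0 :=
  pderiv_eq_zero_of_notMem_vars fun h => hi (mem_supported.1 hf h)

/-- If a prime `f` with `∂f/∂x_i ≠ 0` divides a polynomial of vanishing `∂/∂x_i`, then so does
`f ^ p`, where `p` is the characteristic. -/
theorem pow_char_dvd_of_pderiv_eq_zero {p : ℕ} [CharP K p] {i : σ} {f g : MvPolynomial σ K}
    (hf : Prime f) (hi : pderiv i f ≠ 0) (hg : pderiv i g = 0) (h : f ∣ g) : f ^ p ∣ g := by
  have key : ∀ k ≤ p, f ^ k ∣ g := by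
    intro k
    induction k with
    | zero => simp
    | succ k ih =>
      intro hk
      obtain ⟨q, rfl⟩ := ih (by omega)
      rcases Nat.eq_zero_or_pos k with rfl | hpos
      · simpa using h
      obtain ⟨l, rfl⟩ : ∃ l, k = l + 1 := ⟨k - 1, by omega⟩
      rw [pderiv_mul, pderiv_pow] at hg
      have h0 : f ^ l * (((l + 1 : ℕ) : MvPolynomial σ K) * pderiv i f * q + f * pderiv i q) = 0 := by
        rw [← hg, Nat.add_sub_cancel]; ring
      replace h0 := (mul_eq_zero.1 h0).resolve_left (pow_ne_zero _ hf.ne_zero)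
      have h1 : f ∣ ((l + 1 : ℕ) : MvPolynomial σ K) * pderiv i f * q :=
        (dvd_add_left (Dvd.intro _ rfl)).1 (h0 ▸ dvd_zero f)
      -- The exponent is positive and less than `p`, hence invertible in `K`.
      have hl : IsUnit ((l + 1 : ℕ) : MvPolynomial σ K) := by
        rw [← map_natCast (C : K →+* MvPolynomial σ K)]
        refine (IsUnit.mk0 _ fun h => ?_).map C
        exact absurd (Nat.le_of_dvd (by omega) ((CharP.cast_eq_zero_iff K p _).1 h)) (by omega)
      rcases hf.dvd_or_dvd h1 with h2 | h2
      · rw [hl.dvd_mul_left] at h2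
        exact absurd (pderiv_eq_zero_of_dvd h2) hi
      · rw [pow_succ]
        exact mul_dvd_mul_left _ h2
  exact key p le_rfl

/-- The sum has zero partial derivatives, so it equals `f^p q`, and `q` has zero partial derivatives
too. Writing `q = ∑ b_i u_i^p` and comparing expansions gives `g_i = f u_i`. -/
theorem dvd_of_dvd_sum_C_mul_pow_char {ι : Type*} {p : ℕ} [Fact p.Prime] [CharP K p]
    (b : Module.Basis ι (frobenius K p).fieldRange K) {j : σ} {f : MvPolynomial σ K}
    (hf : Prime f) (hj : pderiv j f ≠ 0) (s : Finset ι) (g : ι → MvPolynomial σ K)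
    (h : f ∣ ∑ i ∈ s, C (b i) * g i ^ p) : ∀ i ∈ s, f ∣ g i := by
  classical
  have hp : p ≠ 0 := (Fact.out : p.Prime).ne_zero
  have hpow : ∀ (q : MvPolynomial σ K) k, pderiv k (q ^ p) = 0 := fun q k => by
    rw [pderiv_pow, CharP.cast_eq_zero, zero_mul, zero_mul]
  have hsum : ∀ k, pderiv k (∑ i ∈ s, C (b i) * g i ^ p) = 0 := fun k => by
    rw [map_sum]
    exact Finset.sum_eq_zero fun i _ => by rw [pderiv_C_mul, hpow, mul_zero]
  obtain ⟨q, hq⟩ := pow_char_dvd_of_pderiv_eq_zero hf hj (hsum j) h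
  have hdq : ∀ k, pderiv k q = 0 := by
    intro k
    have := hsum k
    rw [hq, pderiv_mul, hpow, zero_mul, zero_add] at this
    exact (mul_eq_zero.1 this).resolve_left (pow_ne_zero _ hf.ne_zero)
  obtain ⟨u, -, hu⟩ := exists_eq_sum_C_mul_pow_char b (t := Set.univ) (by simp) hdq
  -- The support of `u` may exceed `s`; outside `s` the missing `g i` count as zero.
  have hzero := eq_zero_of_sum_C_mul_pow_char_eq_zero b.linearIndependent (s ∪ u.support)
    (fun i => (if i ∈ s then g i else 0) - f * u i) (by
      simp only [sub_pow_char, mul_sub, Finset.sum_sub_distrib, ite_pow, zero_pow hp, mul_ite,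
        mul_zero]
      rw [Finset.sum_ite_mem, Finset.union_inter_cancel_left, hq, hu, Finsupp.sum_of_support_subset
        u (Finset.subset_union_right (s₁ := s)) _ (by simp [hp]), Finset.mul_sum, sub_eq_zero]
      exact Finset.sum_congr rfl fun i _ => by ring)
  intro i hi
  have := hzero i (Finset.mem_union_left _ hi)
  simp only [if_pos hi] at this
  exact ⟨u i, sub_eq_zero.1 this⟩

end Degree

/-! ### Pseudo-division in one variable -/

section PseudoDivision

variable {σ K : Type*} [Field K]

theorem exists_eq_X_pow_mul_add {t : Set σ} {g : MvPolynomial σ K} (hg : g ∈ supported K t)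
    {i : σ} (hi : 0 < degreeOf i g) :
    ∃ b ∈ supported K t, ∃ r, b ≠ 0 ∧ degreeOf i b = 0 ∧ degreeOf i r < degreeOf i g ∧
      g = X i ^ degreeOf i g * b + r := by
  set e := degreeOf i g with he
  have hle : ∀ m ∈ g.support, m i ≤ e := degreeOf_le_iff.1 he.ge
  have hgr := divMonomial_add_modMonomial g (Finsupp.single i e)
  rw [← X_pow_eq_monomial] at hgr
  have hr : degreeOf i (g.modMonomial (Finsupp.single i e)) < e := by
    rw [degreeOf_lt_iff hi]
    intro m hm
    by_contra hlt
    exact mem_support_iff.1 hm (coeff_modMonomial_of_le _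
      (Finsupp.single_le_iff.2 (not_lt.1 hlt)))
  refine ⟨g.divMonomial (Finsupp.single i e), ?_, g.modMonomial (Finsupp.single i e), ?_, ?_, hr,
    hgr.symm⟩
  · rw [mem_supported]
    intro j hj
    obtain ⟨m, hm, hmj⟩ := (mem_vars_iff_mem_support j).1 hj
    rw [mem_support_iff, coeff_divMonomial] at hm
    refine mem_supported.1 hg ((mem_vars_iff_mem_support j).2 ⟨_, mem_support_iff.2 hm, ?_⟩)
    rw [Finsupp.mem_support_iff] at hmj ⊢
    rw [Finsupp.add_apply]
    omega
  · intro h0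
    rw [h0, mul_zero, zero_add] at hgr
    rw [hgr, ← he] at hr
    exact lt_irrefl _ hr
  · rw [← Nat.le_zero, degreeOf_le_iff]
    intro m hm
    rw [mem_support_iff, coeff_divMonomial] at hm
    have := hle _ (mem_support_iff.2 hm)
    rw [Finsupp.add_apply, Finsupp.single_eq_same] at this
    omega

/-- A prime `f` of least degree in `x_i` among the nonzero elements of an ideal involving only the
variables in `t` divides all those elements. -/
theorem dvd_of_mem_of_forall_degreeOf_le {t : Set σ} {i : σ} (hi : i ∈ t)
    {P : Ideal (MvPolynomial σ K)} {f : MvPolynomial σ K} (hf : Prime f) (hfP : f ∈ P)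
    (hft : f ∈ supported K t) (hpos : 0 < degreeOf i f)
    (hmin : ∀ g ∈ P, g ≠ 0 → g ∈ supported K t → degreeOf i f ≤ degreeOf i g)
    {g : MvPolynomial σ K} (hg : g ∈ P) (hgt : g ∈ supported K t) : f ∣ g := by
  obtain ⟨c, hct, r', hc0, hcd, hr', hfe⟩ := exists_eq_X_pow_mul_add hft hpos
  induction h : degreeOf i g using Nat.strong_induction_on generalizing g with
  | _ e ih =>
  by_cases hg0 : g = 0
  · simp [hg0]
  have hde := hmin g hg hg0 hgt
  obtain ⟨b, hbt, r, hb0, hbd, hr, hge⟩ := exists_eq_X_pow_mul_add hgt (hpos.trans_le hde)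
  have hX : (X i : MvPolynomial σ K) ∈ supported K t := X_mem_supported.2 hi
  -- Cross-multiplying by the leading coefficients `c` of `f` and `b` of `g` cancels the top terms
  -- in `x_i`.
  have hdiff : c * g - b * X i ^ (degreeOf i g - degreeOf i f) * f =
      c * r - b * X i ^ (degreeOf i g - degreeOf i f) * r' := by
    have hX : (X i : MvPolynomial σ K) ^ degreeOf i g =
        X i ^ (degreeOf i g - degreeOf i f) * X i ^ degreeOf i f := by
      rw [← pow_add, Nat.sub_add_cancel hde]
    linear_combination c * hge - b * X i ^ (degreeOf i g - degreeOf i f) * hfe + c * b * hX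
  have hdeg : degreeOf i (c * g - b * X i ^ (degreeOf i g - degreeOf i f) * f) < e := by
    rw [hdiff]
    refine (degreeOf_sub_le _ _ _).trans_lt (max_lt ?_ ?_)
    · exact (degreeOf_mul_le _ _ _).trans_lt (by omega)
    · refine (degreeOf_mul_le _ _ _).trans_lt ?_
      have h1 := degreeOf_mul_le i b (X i ^ (degreeOf i g - degreeOf i f))
      rw [degreeOf_X_self_pow] at h1
      omega
  have hdvd := ih _ hdeg (P.sub_mem (P.mul_mem_left _ hg) (P.mul_mem_left _ hfP))
    (sub_mem (mul_mem hct hgt) (mul_mem (mul_mem hbt (pow_mem hX _)) hft)) rfl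
  rw [dvd_sub_left (Dvd.intro_left _ rfl)] at hdvd
  -- `c` is free of `x_i`, so `f` cannot divide it.
  refine (hf.dvd_or_dvd hdvd).resolve_left fun hfc => ?_
  have := degreeOf_le_of_dvd (i := i) hc0 hfc
  omega

end PseudoDivision

/-! ### Solving triangular systems -/

section Triangular

variable {K A : Type*} [CommRing K] [Field A] [Algebra K A]

/-- The solution, starting from the values `v₀ j` for `j ≤ n`, of the triangular system
`s * v (n + i + 1) + T i (v 0, …, v (n + i)) = 0`. -/
noncomputable def triangularSolution (n : ℕ) (v₀ : ℕ → A) (s : A) (T : ℕ → MvPolynomial ℕ K)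
    (j : ℕ) : A :=
  if j ≤ n then v₀ j else
    -- The default `0` only makes the recursion well-founded; it is irrelevant when `T (j - n - 1)`
    -- involves only variables below `j`.
    -(aeval (fun i => if i < j then triangularSolution n v₀ s T i else 0) (T (j - n - 1))) / s
termination_by j

theorem aeval_eq_aeval_of_mem_supported {t : Set ℕ} {v w : ℕ → A} (h : ∀ j ∈ t, v j = w j)
    {g : MvPolynomial ℕ K} (hg : g ∈ supported K t) : aeval v g = aeval w g := by
  refine AlgHom.adjoin_le_equalizer (aeval v) (aeval w) ?_ hg
  rintro _ ⟨j, hj, rfl⟩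
  simpa using h j hj

theorem triangularSolution_of_le {n : ℕ} {v₀ : ℕ → A} {s : A} {T : ℕ → MvPolynomial ℕ K} {j : ℕ}
    (hj : j ≤ n) : triangularSolution n v₀ s T j = v₀ j := by
  rw [triangularSolution, if_pos hj]

theorem mul_triangularSolution_add {n : ℕ} {v₀ : ℕ → A} {s : A} (hs : s ≠ 0)
    {T : ℕ → MvPolynomial ℕ K} {i : ℕ} (hT : T i ∈ supported K (Set.Iic (n + i))) :
    s * triangularSolution n v₀ s T (n + i + 1) + aeval (triangularSolution n v₀ s T) (T i) = 0 := by
  rw [triangularSolution, if_neg (by omega), show n + i + 1 - n - 1 = i by omega,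
    mul_div_cancel₀ _ hs, neg_add_eq_zero]
  refine aeval_eq_aeval_of_mem_supported (fun j hj => ?_) hT
  rw [if_pos (Nat.lt_succ_of_le hj)]

end Triangular

end MvPolynomial

theorem le_idealSaturation {R : Type*} [CommRing R] (I : Ideal R) (s : R) :
    I ≤ idealSaturation I s :=
  fun a ha => ⟨0, by simpa using ha⟩

/-! ### Differential ideals and saturation -/

section DifferentialIdealLemmas

variable {R : Type*} [CommRing R] [Differential R]

theorem isDifferentialIdeal_differentialSpan (A : Set R) :
    IsDifferentialIdeal (differentialSpan A) := by
  intro a ha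
  rw [differentialSpan, Submodule.mem_sInf] at ha ⊢
  exact fun I hI => hI.1 a (ha I hI)

theorem differentialSpan_le {A : Set R} {I : Ideal R} (hI : IsDifferentialIdeal I) (hA : A ⊆ I) :
    differentialSpan A ≤ I :=
  sInf_le ⟨hI, hA⟩

theorem subset_differentialSpan (A : Set R) : A ⊆ differentialSpan A := by
  intro a ha
  rw [SetLike.mem_coe, differentialSpan, Submodule.mem_sInf]
  exact fun I hI => hI.2 ha

theorem mem_differentialSpan_self (f : R) : f ∈ differentialSpan {f} :=
  subset_differentialSpan _ rfl

theorem iterate_deriv_mem {I : Ideal R} (hI : IsDifferentialIdeal I) {f : R} (hf : f ∈ I) (i : ℕ) :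
    (fun a : R => a′)^[i] f ∈ I := by
  induction i with
  | zero => exact hf
  | succ i ih =>
    rw [Function.iterate_succ_apply']
    exact hI _ ih

/-- By the Leibniz rule the ideal generated by all derivatives of `f` is already differential. Here
`J` need not be differential, which allows `J` to be the kernel of a plain ring homomorphism. -/
theorem differentialSpan_singleton_le {f : R} {J : Ideal R}
    (h : ∀ i : ℕ, (fun a : R => a′)^[i] f ∈ J) : differentialSpan {f} ≤ J := by
  have hle : Ideal.span (Set.range fun i : ℕ => (fun a : R => a′)^[i] f) ≤ J :=
    Ideal.span_le.2 (by rintro _ ⟨i, rfl⟩; exact h i)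
  refine le_trans (differentialSpan_le ?_ ?_) hle
  · intro a ha
    refine Submodule.span_induction ?_ ?_ ?_ ?_ ha
    · rintro _ ⟨i, rfl⟩
      exact Ideal.subset_span ⟨i + 1, Function.iterate_succ_apply' _ i f⟩
    · simp
    · intro x y _ _ hx hy
      rw [map_add]
      exact add_mem hx hy
    · intro c x hx hx'
      rw [smul_eq_mul, Derivation.leibniz, smul_eq_mul, smul_eq_mul]
      exact add_mem (Ideal.mul_mem_left _ _ hx') (Ideal.mul_mem_right _ _ hx)
  · rintro _ rfl
    exact Ideal.subset_span ⟨0, rfl⟩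

/-- Multiplying `(s^m a)′` by one more `s` turns the unwanted Leibniz term into a multiple of `s^m
a`. -/
theorem IsDifferentialIdeal.idealSaturation {I : Ideal R} (hI : IsDifferentialIdeal I) (s : R) :
    IsDifferentialIdeal (idealSaturation I s) := by
  rintro a ⟨m, hm⟩
  refine ⟨m + 1, ?_⟩
  have h1 := I.mul_mem_left s (hI _ hm)
  rw [Derivation.leibniz, Derivation.leibniz_pow, smul_eq_mul, smul_eq_mul] at h1
  cases m with
  | zero => simpa using h1
  | succ m =>
    have h2 := I.mul_mem_left (((m + 1 : ℕ) : R) * s′) hm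
    have h3 : s ^ (m + 1 + 1) * a′ = s * (s ^ (m + 1) * a′ +
        a * ((m + 1) • s ^ (m + 1 - 1) • s′)) - ((m + 1 : ℕ) : R) * s′ * (s ^ (m + 1) * a) := by
      simp only [Nat.add_sub_cancel, nsmul_eq_mul, smul_eq_mul]
      ring
    rw [h3]
    exact I.sub_mem h1 h2

end DifferentialIdealLemmas

namespace DiffPoly

open MvPolynomial

section Supported

variable {K : Type*} [Field K]

theorem supported_Iic_mono {m n : ℕ} (h : m ≤ n) :
    supported K (Set.Iic m) ≤ supported K (Set.Iic n) :=
  supported_mono (Set.Iic_subset_Iic.2 h)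

theorem X_mem_supported_Iic {m n : ℕ} (h : m ≤ n) :
    (X m : DiffPoly K) ∈ supported K (Set.Iic n) :=
  X_mem_supported.2 h

theorem not_dvd_pderiv {n : ℕ} {f : DiffPoly K} (hs : pderiv n f ≠ 0) : ¬ f ∣ pderiv n f :=
  fun h => hs (pderiv_eq_zero_of_dvd h)

end Supported

universe u

/-! ### Reduction modulo `[f]` and the structure of its saturation -/

section Saturation

variable {K : Type u} [Field K] [Differential K]

/-- This commutation rule lets vanishing of partial derivatives descend from `x_{j+1}` to `x_j`. -/
theorem pderiv_succ_deriv (j : ℕ) (g : DiffPoly K) :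
    pderiv (j + 1) g′ = (pderiv (j + 1) g)′ + pderiv j g := by
  induction g using MvPolynomial.induction_on with
  | C a => simp [deriv_C]
  | add p q hp hq =>
    simp only [map_add, hp, hq]
    ring
  | mul_X p i hp =>
    have h1 : pderiv (j + 1) (X (i + 1) : DiffPoly K) = pderiv j (X i) := by
      simp only [pderiv_X, Pi.single_apply, Nat.add_right_cancel_iff]
    have h2 : (pderiv (j + 1) (X i : DiffPoly K))′ = 0 := by
      simp only [pderiv_X, Pi.single_apply]
      split <;> simp
    simp only [Derivation.leibniz, smul_eq_mul, deriv_X, map_add, hp, h1, h2]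
    ring

theorem deriv_sub_mem_supported {n : ℕ} {g : DiffPoly K} (hg : g ∈ supported K (Set.Iic n)) :
    g′ - pderiv n g * X (n + 1) ∈ supported K (Set.Iic n) := by
  refine Algebra.adjoin_induction
    (p := fun g _ => g′ - pderiv n g * X (n + 1) ∈ supported K (Set.Iic n)) ?_ ?_ ?_ ?_ hg
  · rintro _ ⟨j, hj, rfl⟩
    rw [deriv_X]
    rcases (Set.mem_Iic.1 hj).eq_or_lt with rfl | hlt
    · simp
    · rw [pderiv_X_of_ne hlt.ne, zero_mul, sub_zero]
      exact X_mem_supported.2 hlt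
  · intro r
    rw [algebraMap_eq, deriv_C, pderiv_C, zero_mul, sub_zero, ← algebraMap_eq]
    exact Subalgebra.algebraMap_mem _ _
  · intro x y _ _ hx hy
    rw [map_add, map_add, add_mul, add_sub_add_comm]
    exact add_mem hx hy
  · intro x y hx hy hx' hy'
    have : (x * y)′ - pderiv n (x * y) * X (n + 1) =
        x * (y′ - pderiv n y * X (n + 1)) + y * (x′ - pderiv n x * X (n + 1)) := by
      rw [Derivation.leibniz, pderiv_mul, smul_eq_mul, smul_eq_mul]
      ring
    rw [this]
    exact add_mem (mul_mem hx hy') (mul_mem hy hx')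

theorem deriv_mem_supported {n : ℕ} {g : DiffPoly K} (hg : g ∈ supported K (Set.Iic n)) :
    g′ ∈ supported K (Set.Iic (n + 1)) := by
  rw [← sub_add_cancel g′ (pderiv n g * X (n + 1))]
  exact add_mem (supported_Iic_mono n.le_succ (deriv_sub_mem_supported hg))
    (mul_mem (supported_Iic_mono n.le_succ (pderiv_mem_supported hg n)) (X_mem_supported_Iic le_rfl))

theorem exists_iterate_deriv_eq {n : ℕ} {f : DiffPoly K} (hf : f ∈ supported K (Set.Iic n))
    (i : ℕ) : ∃ T ∈ supported K (Set.Iic (n + i)),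
      (fun a : DiffPoly K => a′)^[i + 1] f = pderiv n f * X (n + i + 1) + T := by
  induction i with
  | zero =>
    exact ⟨_, deriv_sub_mem_supported hf, by simp⟩
  | succ i ih =>
    obtain ⟨T, hT, h⟩ := ih
    refine ⟨(pderiv n f)′ * X (n + i + 1) + T′, add_mem (mul_mem ?_ ?_) ?_, ?_⟩
    · exact supported_Iic_mono (by omega) (deriv_mem_supported (pderiv_mem_supported hf n))
    · exact X_mem_supported_Iic le_rfl
    · exact deriv_mem_supported hT
    · rw [Function.iterate_succ_apply', h, map_add, Derivation.leibniz, deriv_X, smul_eq_mul,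
        smul_eq_mul, ← add_assoc n i 1]
      ring

/-- Reduction modulo the derivatives of `f`, with powers of `∂f/∂x_n` as multipliers. -/
theorem exists_pow_mul_sub_mem_differentialSpan {n : ℕ} {f : DiffPoly K}
    (hf : f ∈ supported K (Set.Iic n)) (g : DiffPoly K) :
    ∃ a : ℕ, ∃ r ∈ supported K (Set.Iic n),
      pderiv n f ^ a * g - r ∈ differentialSpan {f} := by
  set s := pderiv n f
  set I := differentialSpan {f}
  have hs : s ∈ supported K (Set.Iic n) := pderiv_mem_supported hf n
  -- Reducible elements form a subalgebra, so it suffices to reduce the variables.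
  let S : Subalgebra K (DiffPoly K) :=
    { carrier := {g | ∃ a : ℕ, ∃ r ∈ supported K (Set.Iic n), s ^ a * g - r ∈ I}
      algebraMap_mem' := fun c => ⟨0, _, Subalgebra.algebraMap_mem _ c, by simp⟩
      add_mem' := by
        rintro x y ⟨a, r, hr, h⟩ ⟨b, q, hq, h'⟩
        refine ⟨a + b, s ^ b * r + s ^ a * q, add_mem (mul_mem (pow_mem hs _) hr)
          (mul_mem (pow_mem hs _) hq), ?_⟩
        have : s ^ (a + b) * (x + y) - (s ^ b * r + s ^ a * q) =
            s ^ b * (s ^ a * x - r) + s ^ a * (s ^ b * y - q) := by ring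
        rw [this]
        exact I.add_mem (I.mul_mem_left _ h) (I.mul_mem_left _ h')
      mul_mem' := by
        rintro x y ⟨a, r, hr, h⟩ ⟨b, q, hq, h'⟩
        refine ⟨a + b, r * q, mul_mem hr hq, ?_⟩
        have : s ^ (a + b) * (x * y) - r * q =
            s ^ b * y * (s ^ a * x - r) + r * (s ^ b * y - q) := by ring
        rw [this]
        exact I.add_mem (I.mul_mem_left _ h) (I.mul_mem_left _ h') }
  have hX : ∀ j, (X j : DiffPoly K) ∈ S := by
    intro j
    induction j using Nat.strong_induction_on with
    | _ j ih =>
    rcases le_or_gt j n with hj | hj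
    · exact ⟨0, _, X_mem_supported_Iic hj, by simp⟩
    obtain ⟨i, rfl⟩ : ∃ i, j = n + i + 1 := ⟨j - n - 1, by omega⟩
    obtain ⟨T, hT, h⟩ := exists_iterate_deriv_eq hf i
    have hTS : T ∈ S := by
      refine (Algebra.adjoin_le ?_ : supported K (Set.Iic (n + i)) ≤ S) hT
      rintro _ ⟨k, hk, rfl⟩
      exact ih k (Nat.lt_succ_of_le hk)
    obtain ⟨a, r, hr, hTr⟩ := hTS
    refine ⟨a + 1, -r, neg_mem hr, ?_⟩
    have hmem : (fun a : DiffPoly K => a′)^[i + 1] f ∈ I :=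
      iterate_deriv_mem (isDifferentialIdeal_differentialSpan _) (mem_differentialSpan_self f) _
    have : s ^ (a + 1) * X (n + i + 1) - -r =
        s ^ a * (fun a : DiffPoly K => a′)^[i + 1] f - (s ^ a * T - r) := by rw [h]; ring
    rw [this]
    exact I.sub_mem (I.mul_mem_left _ hmem) hTr
  have hg : g ∈ supported K (Set.univ : Set ℕ) := by simp
  refine (Algebra.adjoin_le ?_ : supported K (Set.univ : Set ℕ) ≤ S) hg
  rintro _ ⟨k, -, rfl⟩
  exact hX k

/-- Solving the equations `δⁱ f = 0` for `x_{n+1}, x_{n+2}, …` over `Frac (K{x} / (f))`. -/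
theorem exists_ringHom_iterate_deriv_eq_zero {n : ℕ} {f : DiffPoly K} (hprime : Prime f)
    (hf : f ∈ supported K (Set.Iic n)) (hs : pderiv n f ≠ 0) :
    ∃ (A : Type u) (_ : Field A) (φ : DiffPoly K →+* A),
      (∀ g ∈ supported K (Set.Iic n), φ g = 0 ↔ f ∣ g) ∧
      ∀ i : ℕ, φ ((fun a : DiffPoly K => a′)^[i] f) = 0 := by
  have hP : (Ideal.span {f}).IsPrime := (Ideal.span_singleton_prime hprime.ne_zero).2 hprime
  let B := DiffPoly K ⧸ Ideal.span {f}
  let A := FractionRing B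
  let ψ : DiffPoly K →ₐ[K] A := (IsScalarTower.toAlgHom K B A).comp (Ideal.Quotient.mkₐ K _)
  have hψ : ∀ g, ψ g = 0 ↔ f ∣ g := fun g => by
    rw [← Ideal.mem_span_singleton, ← Ideal.Quotient.eq_zero_iff_mem]
    exact FaithfulSMul.algebraMap_eq_zero_iff B A
  choose T hT hTe using exists_iterate_deriv_eq hf
  -- The variables up to `x_n` keep their residue classes modulo `f`; the later ones are forced by
  -- the derivatives of `f`.
  let v : ℕ → A := triangularSolution n (fun j => ψ (X j)) (ψ (pderiv n f)) T
  have hv : ∀ g ∈ supported K (Set.Iic n), aeval v g = ψ g := fun g hg => by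
    rw [aeval_unique ψ]
    exact aeval_eq_aeval_of_mem_supported (fun j hj => triangularSolution_of_le hj) hg
  refine ⟨A, inferInstance, (aeval v : DiffPoly K →ₐ[K] A), fun g hg => ?_, fun i => ?_⟩
  · rw [← hψ, ← hv g hg]; rfl
  · change aeval v _ = 0
    cases i with
    | zero => exact (hv f hf).trans ((hψ f).2 dvd_rfl)
    | succ i =>
      rw [hTe, map_add, map_mul, aeval_X, hv _ (pderiv_mem_supported hf n)]
      exact mul_triangularSolution_add (fun h => not_dvd_pderiv hs ((hψ _).1 h)) (hT i)

/-- If `φ g = 0`, the reduction `r` of `g` is also killed, so `f ∣ r` and `s^a g ∈ [f]`. Conversely,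
`φ s ≠ 0` can be cancelled in a field. -/
theorem exists_ringHom_ker_eq_idealSaturation {n : ℕ} {f : DiffPoly K} (hprime : Prime f)
    (hf : f ∈ supported K (Set.Iic n)) (hs : pderiv n f ≠ 0) :
    ∃ (A : Type u) (_ : Field A) (φ : DiffPoly K →+* A),
      (∀ g ∈ supported K (Set.Iic n), φ g = 0 ↔ f ∣ g) ∧
      RingHom.ker φ = idealSaturation (differentialSpan {f}) (pderiv n f) := by
  obtain ⟨A, _, φ, hφ, hi⟩ := exists_ringHom_iterate_deriv_eq_zero hprime hf hs
  have hle : differentialSpan {f} ≤ RingHom.ker φ :=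
    differentialSpan_singleton_le fun i => RingHom.mem_ker.2 (hi i)
  have hφs : φ (pderiv n f) ≠ 0 := fun h =>
    not_dvd_pderiv hs ((hφ _ (pderiv_mem_supported hf n)).1 h)
  refine ⟨A, inferInstance, φ, hφ, le_antisymm ?_ ?_⟩
  · intro g hg
    obtain ⟨a, r, hr, h⟩ := exists_pow_mul_sub_mem_differentialSpan hf g
    have h0 := RingHom.mem_ker.1 (hle h)
    rw [map_sub, map_mul, RingHom.mem_ker.1 hg, mul_zero, zero_sub, neg_eq_zero, hφ r hr] at h0
    refine ⟨a, ?_⟩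
    rw [← sub_add_cancel (pderiv n f ^ a * g) r]
    exact Ideal.add_mem _ h (Ideal.mem_of_dvd _ h0 (mem_differentialSpan_self f))
  · rintro g ⟨m, hm⟩
    have h0 := RingHom.mem_ker.1 (hle hm)
    rw [map_mul, map_pow] at h0
    exact (mul_eq_zero.1 h0).resolve_left (pow_ne_zero _ hφs)

theorem isPrime_idealSaturation {n : ℕ} {f : DiffPoly K} (hprime : Prime f)
    (hf : f ∈ supported K (Set.Iic n)) (hs : pderiv n f ≠ 0) :
    (idealSaturation (differentialSpan {f}) (pderiv n f)).IsPrime := by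
  obtain ⟨A, _, φ, -, h⟩ := exists_ringHom_ker_eq_idealSaturation hprime hf hs
  rw [← h]
  exact RingHom.ker_isPrime φ

theorem dvd_of_mem_idealSaturation {n : ℕ} {f : DiffPoly K} (hprime : Prime f)
    (hf : f ∈ supported K (Set.Iic n)) (hs : pderiv n f ≠ 0) {g : DiffPoly K}
    (hg : g ∈ idealSaturation (differentialSpan {f}) (pderiv n f))
    (hgn : g ∈ supported K (Set.Iic n)) : f ∣ g := by
  obtain ⟨A, _, φ, hφ, h⟩ := exists_ringHom_ker_eq_idealSaturation hprime hf hs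
  rw [← h] at hg
  exact (hφ g hgn).1 hg

/-- Clearing denominators and reducing turns a relation `∑ b_i u_i^p = 0` into divisibility of `∑
b_i g_i^p` by `f`, with all `g_i` of order at most `n`. -/
theorem isSeparableExtension_idealSaturation {n : ℕ} {f : DiffPoly K} (hprime : Prime f)
    (hf : f ∈ supported K (Set.Iic n)) (hs : pderiv n f ≠ 0)
    [hQp : (idealSaturation (differentialSpan {f}) (pderiv n f)).IsPrime] :
    IsSeparableExtension K
      (FractionRing (DiffPoly K ⧸ idealSaturation (differentialSpan {f}) (pderiv n f))) := by
  set Q := idealSaturation (differentialSpan {f}) (pderiv n f) with hQ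
  have hfQ : f ∈ Q := le_idealSaturation _ _ (mem_differentialSpan_self f)
  have hsQ : pderiv n f ∉ Q := fun h => not_dvd_pderiv hs
    (dvd_of_mem_idealSaturation hprime hf hs h (pderiv_mem_supported hf n))
  rw [isSeparableExtension_iff_basis]
  intro p _ _ t u hu
  set b := Module.Basis.ofVectorSpace (frobenius K p).fieldRange K
  obtain ⟨d, hd⟩ := IsLocalization.exist_integer_multiples (nonZeroDivisors (DiffPoly K ⧸ Q)) t u
  have hw : ∀ i, ∃ w : DiffPoly K, i ∈ t → algebraMap (DiffPoly K ⧸ Q)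
      (FractionRing (DiffPoly K ⧸ Q)) (Ideal.Quotient.mk Q w) = (d : DiffPoly K ⧸ Q) • u i := by
    intro i
    by_cases hi : i ∈ t
    · obtain ⟨y, hy⟩ := hd i hi
      obtain ⟨w, rfl⟩ := Ideal.Quotient.mk_surjective y
      exact ⟨w, fun _ => hy⟩
    · exact ⟨0, fun h => absurd h hi⟩
  choose w hw using hw
  have hsum : ∑ i ∈ t, C (b i) * w i ^ p ∈ Q := by
    rw [← Ideal.Quotient.eq_zero_iff_mem, ← FaithfulSMul.algebraMap_eq_zero_iff _
      (FractionRing (DiffPoly K ⧸ Q)), map_sum, map_sum]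
    have : ∀ i ∈ t, algebraMap (DiffPoly K ⧸ Q) (FractionRing (DiffPoly K ⧸ Q))
        (Ideal.Quotient.mk Q (C (b i) * w i ^ p)) =
        algebraMap _ (FractionRing (DiffPoly K ⧸ Q)) (d : DiffPoly K ⧸ Q) ^ p *
          (algebraMap K (FractionRing (DiffPoly K ⧸ Q)) (b i) * u i ^ p) := by
      intro i hi
      have hC : algebraMap (DiffPoly K ⧸ Q) (FractionRing (DiffPoly K ⧸ Q))
        (Ideal.Quotient.mk Q (C (b i))) = algebraMap K _ (b i) := rfl
      rw [map_mul, map_mul, map_pow, map_pow, hw i hi, hC, Algebra.smul_def]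
      ring
    rw [Finset.sum_congr rfl this, ← Finset.mul_sum, hu, mul_zero]
  choose a r hr har using fun i => exists_pow_mul_sub_mem_differentialSpan hf (w i)
  -- One exponent of the separant that serves every `w i`, so that the relation can be multiplied
  -- through.
  set N := ∑ i ∈ t, a i
  let g : _ → DiffPoly K := fun i => pderiv n f ^ (N - a i) * r i
  have hg : ∀ i ∈ t, pderiv n f ^ N * w i - g i ∈ Q := by
    intro i hi
    have hle : a i ≤ N := Finset.single_le_sum (fun _ _ => Nat.zero_le _) hi
    have : pderiv n f ^ N * w i - g i =
        pderiv n f ^ (N - a i) * (pderiv n f ^ a i * w i - r i) := by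
      rw [mul_sub, ← mul_assoc, ← pow_add, Nat.sub_add_cancel hle]
    rw [this]
    exact Q.mul_mem_left _ (le_idealSaturation _ _ (har i))
  have hgsum : ∑ i ∈ t, C (b i) * g i ^ p ∈ Q := by
    have h1 : (pderiv n f ^ N) ^ p * (∑ i ∈ t, C (b i) * w i ^ p) -
        ∑ i ∈ t, C (b i) * g i ^ p ∈ Q := by
      rw [Finset.mul_sum, ← Finset.sum_sub_distrib]
      refine Q.sum_mem fun i hi => ?_
      have : (pderiv n f ^ N) ^ p * (C (b i) * w i ^ p) - C (b i) * g i ^ p =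
          C (b i) * (pderiv n f ^ N * w i - g i) ^ p := by
        rw [sub_pow_char]; ring
      rw [this]
      exact Q.mul_mem_left _ (Q.pow_mem_of_mem (hg i hi) _ (Fact.out : p.Prime).pos)
    exact (Q.sub_mem_iff_right (Q.mul_mem_left _ hsum)).1 h1
  have hsn := pderiv_mem_supported hf n
  have hdvd := dvd_of_dvd_sum_C_mul_pow_char b hprime hs t g
    (dvd_of_mem_idealSaturation hprime hf hs hgsum (Subalgebra.sum_mem _ fun i _ =>
      mul_mem (Subalgebra.algebraMap_mem _ _) (pow_mem (mul_mem (pow_mem hsn _) (hr i)) _)))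
  intro i hi
  have h1 : pderiv n f ^ N * w i ∈ Q :=
    (Q.sub_mem_iff_left (Ideal.mem_of_dvd _ (hdvd i hi) hfQ)).1 (hg i hi)
  have h2 : w i ∈ Q := (hQp.mem_or_mem h1).resolve_left fun h => hsQ (hQp.mem_of_pow_mem _ h)
  have h3 := hw i hi
  rw [Ideal.Quotient.eq_zero_iff_mem.2 h2, map_zero, Algebra.smul_def, eq_comm, mul_eq_zero] at h3
  exact h3.resolve_left (IsFractionRing.to_map_ne_zero_of_mem_nonZeroDivisors d.2)

/-- In a separable prime differential ideal, an irreducible `f` of order `n` that divides all the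
elements of order at most `n` has nonzero separant. -/
theorem pderiv_ne_zero_of_isSeparablePrimeDifferential {P : Ideal (DiffPoly K)}
    (hP : IsSeparablePrimeDifferential P) {n : ℕ} {f : DiffPoly K} (hprime : Prime f)
    (hfP : f ∈ P) (hf : f ∈ supported K (Set.Iic n)) (hpos : 0 < degreeOf n f)
    (hdvd : ∀ g ∈ P, g ∈ supported K (Set.Iic n) → f ∣ g) : pderiv n f ≠ 0 := by
  have hPp := hP.isPrime
  intro h0
  -- Descending induction on `j`: as the separant is zero, `f′` has order at most `n`, so `f′ = f
  -- q`. Applying `∂/∂x_{j+1}`, which kills `f`, shows that `f` divides `∂f/∂x_j`.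
  have hall : ∀ m j, n ≤ j + m → pderiv j f = 0 := by
    intro m
    induction m with
    | zero =>
      intro j hj
      rcases (show n ≤ j from hj).eq_or_lt with rfl | hlt
      · exact h0
      · exact pderiv_eq_zero_of_mem_supported hf (by simpa using hlt)
    | succ m ih =>
      intro j hj
      have hmem := deriv_sub_mem_supported hf
      rw [h0, zero_mul, sub_zero] at hmem
      obtain ⟨q, hq⟩ := hdvd _ (hP.isDifferential f hfP) hmem
      have h1 := pderiv_succ_deriv j f
      rw [ih (j + 1) (by omega), map_zero, zero_add, hq, pderiv_mul, ih (j + 1) (by omega),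
        zero_mul, zero_add] at h1
      exact pderiv_eq_zero_of_dvd ⟨_, h1.symm⟩
  obtain ⟨p, hp⟩ := CharP.exists K
  rcases CharP.char_is_prime_or_zero K p with hpp | rfl
  · have : Fact p.Prime := ⟨hpp⟩
    obtain ⟨u, hu, hfu⟩ := exists_eq_sum_C_mul_pow_char
      (Module.Basis.ofVectorSpace (frobenius K p).fieldRange K) hf
      (fun j => hall n j (by omega))
    have hsep := isSeparableExtension_iff_basis.1 hP.isSeparable p u.support
      (fun i => algebraMap (DiffPoly K ⧸ P) _ (Ideal.Quotient.mk P (u i))) (by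
        have h1 : algebraMap (DiffPoly K ⧸ P) (FractionRing (DiffPoly K ⧸ P))
            (Ideal.Quotient.mk P f) = 0 := by
          rw [Ideal.Quotient.eq_zero_iff_mem.2 hfP, map_zero]
        rw [hfu, Finsupp.sum, map_sum, map_sum] at h1
        rw [← h1]
        refine Finset.sum_congr rfl fun i _ => ?_
        rw [map_mul, map_mul, map_pow, map_pow]
        rfl)
    -- Separability puts each `u i` in `P`; being of order at most `n`, it is a multiple of `f`.
    have hfp : f ^ p ∣ f := by
      conv_rhs => rw [hfu]
      refine Finset.dvd_sum fun i hi => Dvd.dvd.mul_left (pow_dvd_pow_of_dvd ?_ p) _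
      have h1 := (FaithfulSMul.algebraMap_eq_zero_iff _ _).1 (hsep i hi)
      exact hdvd _ (Ideal.Quotient.eq_zero_iff_mem.1 h1) (hu i)
    have h2 : f ^ 2 ∣ f ^ 1 := by
      rw [pow_one]
      exact (pow_dvd_pow f hpp.two_le).trans hfp
    exact absurd ((pow_dvd_pow_iff hprime.ne_zero hprime.not_isUnit).1 h2) (by norm_num)
  · have := CharP.charP_to_charZero K
    have hlt : ∀ m ∈ f.support, m n < 1 := by
      intro m hm
      by_contra hge
      have hle : Finsupp.single n 1 ≤ m := Finsupp.single_le_iff.2 (not_lt.1 hge)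
      have h1 := congrArg (coeff (m - Finsupp.single n 1)) h0
      rw [coeff_pderiv, tsub_add_cancel_of_le hle, coeff_zero] at h1
      rcases mul_eq_zero.1 h1 with h1 | h1
      · exact mem_support_iff.1 hm h1
      · exact Nat.cast_add_one_ne_zero _ h1
    have := (degreeOf_lt_iff one_pos).2 hlt
    omega

end Saturation

/-! ### Comparison of ranks -/

section Rank

variable {K : Type*} [Field K]

theorem mem_supported_of_ord_eq {f : DiffPoly K} {n : ℕ} (h : ord f = n) :
    f ∈ supported K (Set.Iic n) := by
  rw [mem_supported]
  intro j hj
  exact Finset.le_max_of_eq hj h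

theorem degreeOf_pos_of_ord_eq {f : DiffPoly K} {n : ℕ} (h : ord f = n) : 0 < degreeOf n f :=
  Nat.pos_of_ne_zero (mem_vars_iff_degreeOf_ne_zero.1 (Finset.mem_of_max h))

theorem separant_of_ord_eq {f : DiffPoly K} {n : ℕ} (h : ord f = n) :
    separant f = pderiv n f := by
  rw [separant, h]
  rfl

theorem rank_of_ord_eq {f : DiffPoly K} {n : ℕ} (h : ord f = n) :
    rank f = (toLex (n, degreeOf n f) : ℕ ×ₗ ℕ) := by
  rw [rank, h]
  rfl

theorem exists_ord_eq_of_irreducible {f : DiffPoly K} (hf : Irreducible f) :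
    ∃ n : ℕ, ord f = n := by
  rcases h : ord f with _ | n
  · have hv : f.vars = ∅ := Finset.max_eq_bot.1 h
    have hC : f ∈ supported K (∅ : Set ℕ) := by rw [mem_supported, hv]; simp
    rw [supported_empty, Algebra.mem_bot] at hC
    obtain ⟨c, rfl⟩ := hC
    refine absurd ((IsUnit.mk0 c fun hc => ?_).map (algebraMap K (DiffPoly K))) hf.not_isUnit
    exact hf.ne_zero (by rw [hc, map_zero])
  · exact ⟨n, rfl⟩

theorem degreeOf_le_of_rank_le {f g : DiffPoly K} {n : ℕ} (hf : ord f = n)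
    (hg : g ∈ supported K (Set.Iic n)) (h : rank f ≤ rank g) : degreeOf n f ≤ degreeOf n g := by
  rw [rank_of_ord_eq hf] at h
  rcases hk : ord g with _ | k
  · rw [rank, hk] at h
    exact absurd h (WithBot.not_coe_le_bot _)
  · rw [rank_of_ord_eq hk, WithBot.coe_le_coe, Prod.Lex.toLex_le_toLex] at h
    have hkn : k ≤ n := mem_supported.1 hg (Finset.mem_of_max hk)
    rcases h with h | ⟨h1, h2⟩
    · exact absurd hkn (not_le.2 h)
    · obtain rfl : n = k := h1
      exact h2

theorem rank_le_of_dvd_of_mem_supported {f g : DiffPoly K} {n : ℕ} (hf : ord f = n) (hg : g ≠ 0)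
    (h : g ∈ supported K (Set.Iic n) → f ∣ g) : rank f ≤ rank g := by
  rcases le_or_gt (ord g) n with hle | hgt
  · have hgn : g ∈ supported K (Set.Iic n) := mem_supported.2 fun j hj =>
      WithBot.coe_le_coe.1 ((Finset.le_max hj).trans hle)
    have hdeg := degreeOf_le_of_dvd (i := n) hg (h hgn)
    have hmem : n ∈ g.vars :=
      mem_vars_iff_degreeOf_ne_zero.2 (by have := degreeOf_pos_of_ord_eq hf; omega)
    rw [rank_of_ord_eq hf, rank_of_ord_eq (le_antisymm hle (Finset.le_max hmem)),
      WithBot.coe_le_coe, Prod.Lex.toLex_le_toLex]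
    exact Or.inr ⟨rfl, hdeg⟩
  · rcases hk : ord g with _ | k
    · rw [hk] at hgt
      exact absurd hgt not_lt_bot
    · rw [hk] at hgt
      rw [rank_of_ord_eq hf, rank_of_ord_eq hk, WithBot.coe_le_coe, Prod.Lex.toLex_le_toLex]
      exact Or.inl (WithBot.coe_lt_coe.1 hgt)

end Rank

/-! ### The two halves of the theorem -/

section MainResults

variable {K : Type*} [Field K] [Differential K]

theorem IsSeparablePrimeDifferential.eq_idealSaturation {P : Ideal (DiffPoly K)}
    (hP : IsSeparablePrimeDifferential P) {f : DiffPoly K} (hirr : Irreducible f)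
    (hmin : HasMinimalRank f P) :
    P = idealSaturation (differentialSpan {f}) (separant f) := by
  have hPp := hP.isPrime
  obtain ⟨n, hn⟩ := exists_ord_eq_of_irreducible hirr
  have hprime : Prime f := hirr.prime
  have hf := mem_supported_of_ord_eq hn
  have hpos := degreeOf_pos_of_ord_eq hn
  have hdvd : ∀ g ∈ P, g ∈ supported K (Set.Iic n) → f ∣ g := fun g hg hgn =>
    dvd_of_mem_of_forall_degreeOf_le (Set.mem_Iic.2 le_rfl) hprime hmin.1 hf hpos
      (fun g hg hg0 hgn => degreeOf_le_of_rank_le hn hgn (hmin.2.2 g hg hg0)) hg hgn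
  have hs := pderiv_ne_zero_of_isSeparablePrimeDifferential hP hprime hmin.1 hf hpos hdvd
  have hsP : pderiv n f ∉ P := fun h =>
    not_dvd_pderiv hs (hdvd _ h (pderiv_mem_supported hf n))
  have hle : differentialSpan {f} ≤ P :=
    differentialSpan_le hP.isDifferential (Set.singleton_subset_iff.2 hmin.1)
  rw [separant_of_ord_eq hn]
  refine le_antisymm ?_ ?_
  · intro g hg
    obtain ⟨a, r, hr, h⟩ := exists_pow_mul_sub_mem_differentialSpan hf g
    have hrP : r ∈ P := (P.sub_mem_iff_right (P.mul_mem_left _ hg)).1 (hle h)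
    refine ⟨a, ?_⟩
    rw [← sub_add_cancel (pderiv n f ^ a * g) r]
    exact Ideal.add_mem _ h (Ideal.mem_of_dvd _ (hdvd r hrP hr) (mem_differentialSpan_self f))
  · rintro g ⟨m, hm⟩
    exact (hPp.mem_or_mem (hle hm)).resolve_left fun h => hsP (hPp.mem_of_pow_mem _ h)

theorem isSeparablePrimeDifferential_idealSaturation {f : DiffPoly K} (hirr : Irreducible f)
    (hs : separant f ≠ 0) :
    IsSeparablePrimeDifferential (idealSaturation (differentialSpan {f}) (separant f)) ∧
      HasMinimalRank f (idealSaturation (differentialSpan {f}) (separant f)) := by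
  obtain ⟨n, hn⟩ := exists_ord_eq_of_irreducible hirr
  have hprime : Prime f := hirr.prime
  have hf := mem_supported_of_ord_eq hn
  rw [separant_of_ord_eq hn] at hs ⊢
  have hQ := isPrime_idealSaturation hprime hf hs
  refine ⟨⟨hQ,
    (isDifferentialIdeal_differentialSpan _).idealSaturation _,
    isSeparableExtension_idealSaturation hprime hf hs⟩,
    le_idealSaturation _ _ (mem_differentialSpan_self f), hirr.ne_zero, fun g hg hg0 => ?_⟩
  exact rank_le_of_dvd_of_mem_supported hn hg0
    (dvd_of_mem_idealSaturation hprime hf hs hg)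

end MainResults

end DiffPoly

theorem mainTheorem4 {K : Type*} [Field K] [Differential K] :
    (∀ P : Ideal (DiffPoly K), P ≠ ⊥ → DiffPoly.IsSeparablePrimeDifferential P →
      ∀ f : DiffPoly K, Irreducible f → DiffPoly.HasMinimalRank f P →
        P = idealSaturation (differentialSpan {f}) (DiffPoly.separant f)) ∧
    (∀ f : DiffPoly K, Irreducible f → DiffPoly.separant f ≠ 0 →
      DiffPoly.IsSeparablePrimeDifferential
        (idealSaturation (differentialSpan {f}) (DiffPoly.separant f)) ∧
      DiffPoly.HasMinimalRank f
        (idealSaturation (differentialSpan {f}) (DiffPoly.separant f))) :=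
  ⟨fun _ _ hP _ hirr hmin => hP.eq_idealSaturation hirr hmin,
    fun _ hirr hs => DiffPoly.isSeparablePrimeDifferential_idealSaturation hirr hs⟩
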